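/- Let $S$ be a nonempty commutative semigroup (written additively) and $G$ a group. A map $f:S\to G$ is a *polynomial map of degree $\le-\infty$* if $f\equiv 1_G$, and *of degree $\le 0$* if it is constant; for an integer $d\ge0$ it is a polynomial map *of degree $\le d+1$* if for every $s\in S$ both maps $t\mapsto f(s+t)f(t)^{-1}$ and $t\mapsto f(t)^{-1}f(s+t)$ are polynomial maps of degree $\le d$. The *degree* of a polynomial map is the least $d\in\mathbb N_0\cup\{-\infty\}$ such that it is a polynomial map of degree $\le d$. In $\mathbb N_0\cup\{-\infty\}$ put $-\infty+a=-\infty$ for all $a$, and let the maximum of the empty set be $-\infty$. **Theorem.** Let $N\ge0$ and $n\ge1$ be integers, let $\mathcal U_n(\mathbb R)$ be the group of upper unitriangular real $n\times n$ matrices with its usual topology, and let $f:\mathbb R_{\ge0}^N\to\mathcal U_n(\mathbb R)$ be continuous with entries $f_{i,j}:\mathbb R_{\ge0}^N\to(\mathbb R,+)$, $1\le i<j\le n$. Then $f$ is a polynomial map if and only if all the $f_{i,j}$ with $i<j$ are polynomial maps. In this case let $d_{i,j}\in\mathbb N_0\cup\{-\infty\}$ be the degree of $f_{i,j}$ for $i<j$.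 Then the degree of $f$ is at least $$\max\{d_{k,k+1}\mid 1\le k\le n-1\},$$ and at most $$\max\{\delta_{k_1,k_2}+\cdots+\delta_{k_{n-1},k_n}\mid 1=k_1\le k_2\le\cdots\le k_{n-1}\le k_n=n\}$$ for every family of $\delta_{i,j}\in\mathbb N_0\cup\{-\infty\}$ such that $\delta_{i,i}=0$ for all $i$, $\delta_{i,j}\ge d_{i,j}$ for all $i<j$, and $\delta_{i,j}\ge0$ whenever $i<j$ and ($i=1$ or $j=n$). In particular, if no entry $f_{1,j}$ $(1<j\le n)$ and no entry $f_{i,n}$ $(1\le i<n)$ vanishes identically, then with $d_{i,i}:=0$ the degree of $f$ is at most $$\max\{d_{k_1,k_2}+\cdots+d_{k_{n-1},k_n}\mid 1=k_1\le k_2\le\cdots\le k_{n-1}\le k_n=n\};$$ in general one may take $\delta_{i,j}=\max\{d_{i,j},0\}$. -/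

import Mathlib

open scoped NNReal

/-- The left forward difference `L_s f : t ↦ f (s + t) * (f t)⁻¹`. -/
def leftDiff {S G : Type*} [Add S] [Group G] (s : S) (f : S → G) : S → G :=
  fun t => f (s + t) * (f t)⁻¹

/-- The right forward difference `R_s f : t ↦ (f t)⁻¹ * f (s + t)`. -/
def rightDiff {S G : Type*} [Add S] [Group G] (s : S) (f : S → G) : S → G :=
  fun t => (f t)⁻¹ * f (s + t)

/-- `f` is a polynomial map of degree `≤ d`, for a natural number `d`: for `d = 0` this means that
`f` is constant, and `f` has degree `≤ d + 1` if all its left and right forward differences have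
degree `≤ d`. -/
def NatDegreeLE {S G : Type*} [Add S] [Group G] : ℕ → (S → G) → Prop
  | 0, f => ∃ g : G, ∀ t, f t = g
  | d + 1, f => ∀ s, NatDegreeLE d (leftDiff s f) ∧ NatDegreeLE d (rightDiff s f)

/-- `f` is a polynomial map of degree `≤ d`, where `d ∈ ℕ ∪ {-∞}`; the value `⊥` plays the role of
`-∞`, and degree `-∞` means that `f` is identically the identity of `G`. -/
def DegreeLE {S G : Type*} [Add S] [Group G] (d : WithBot ℕ) (f : S → G) : Prop :=
  (∀ t, f t = 1) ∨ ∃ m : ℕ, d = (m : WithBot ℕ) ∧ NatDegreeLE m f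

/-- `f` is a polynomial map (of some degree). -/
def IsPolynomialMap {S G : Type*} [Add S] [Group G] (f : S → G) : Prop :=
  ∃ d : WithBot ℕ, DegreeLE d f

/-- `f` is a polynomial map whose degree is exactly `d`: the least `d ∈ ℕ ∪ {-∞}` such that `f` is
a polynomial map of degree `≤ d`. -/
def HasDegree {S G : Type*} [Add S] [Group G] (f : S → G) (d : WithBot ℕ) : Prop :=
  IsLeast {e : WithBot ℕ | DegreeLE e f} d

/-- The group `U_n(ℝ)` of upper unitriangular real matrices. As such a matrix has determinant `1`
(see `det_eq_one_of_unitriangular`), it can be taken inside `SL_n(ℝ)`, from which it inherits its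
group structure and its topology, which is the one induced by the matrix entries. -/
def Unitriangular (n : ℕ) : Subgroup (Matrix.SpecialLinearGroup (Fin n) ℝ) where
  carrier := {A | (∀ i, A.1 i i = 1) ∧ ∀ i j, j < i → A.1 i j = 0}
  one_mem' := ⟨fun i => by simp, fun i j h => by simp [Matrix.one_apply_ne h.ne']⟩
  mul_mem' := by
    rintro A B ⟨hA1, hA0⟩ ⟨hB1, hB0⟩
    refine ⟨fun i => ?_, fun i j hij => ?_⟩
    · rw [Matrix.SpecialLinearGroup.coe_mul, Matrix.mul_apply, Finset.sum_eq_single i]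
      · rw [hA1, hB1, one_mul]
      · intro k _ hk
        rcases lt_or_gt_of_ne hk with h | h
        · rw [hA0 i k h, zero_mul]
        · rw [hB0 k i h, mul_zero]
      · simp
    · rw [Matrix.SpecialLinearGroup.coe_mul, Matrix.mul_apply]
      refine Finset.sum_eq_zero fun k _ => ?_
      rcases lt_or_ge k i with h | h
      · rw [hA0 i k h, zero_mul]
      · rw [hB0 k j (hij.trans_le h), mul_zero]
  inv_mem' := by
    rintro A ⟨hA1, hA0⟩
    have hmul : (A⁻¹).1 * A.1 = 1 := by
      rw [← Matrix.SpecialLinearGroup.coe_mul, inv_mul_cancel, Matrix.SpecialLinearGroup.coe_one]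
    have hinv : A.1⁻¹ = (A⁻¹).1 := Matrix.inv_eq_left_inv hmul
    have : Invertible A.1 := invertibleOfLeftInverse _ _ hmul
    have hbt : Matrix.BlockTriangular A.1 id := fun i j h => hA0 i j h
    have h0 : ∀ i j, j < i → (A⁻¹).1 i j = 0 := fun i j h => by
      have := Matrix.blockTriangular_inv_of_blockTriangular hbt
      rw [hinv] at this
      exact this h
    refine ⟨fun i => ?_, h0⟩
    have hii := congrFun (congrFun hmul i) i
    rw [Matrix.mul_apply, Finset.sum_eq_single i, hA1, mul_one, Matrix.one_apply_eq] at hii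
    · exact hii
    · intro k _ hk
      rcases lt_or_gt_of_ne hk with h | h
      · rw [h0 i k h, zero_mul]
      · rw [hA0 k i h, mul_zero]
    · simp

theorem det_eq_one_of_unitriangular {n : ℕ} (A : Matrix (Fin n) (Fin n) ℝ)
    (h1 : ∀ i, A i i = 1) (h0 : ∀ i j, j < i → A i j = 0) : A.det = 1 := by
  rw [Matrix.det_of_isUpperTriangular (fun i j h => h0 i j h)]
  simp [h1]

/-- The `(i, j)` entry of a map into `U_n(ℝ)`, as a map into the additive group of `ℝ` (which is
written as `Multiplicative ℝ` because polynomial maps are defined for multiplicative groups). -/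
def entryMap {S : Type*} {n : ℕ} (f : S → Unitriangular n) (i j : Fin n) :
    S → Multiplicative ℝ :=
  fun t => Multiplicative.ofAdd ((f t).1.1 i j)

/-- For `n = m + 1`: the maximum of `d_{1,2}, d_{2,3}, …, d_{n-1,n}` (equal to `-∞` if `n = 1`);
the indices `1, …, n` are represented by `0, …, m`. -/
def superdiagMax {m : ℕ} (d : Fin (m + 1) → Fin (m + 1) → WithBot ℕ) : WithBot ℕ :=
  Finset.univ.sup fun k : Fin m => d k.castSucc k.succ

open Classical in
/-- For `n = m + 1`: the maximum of `d_{k₁,k₂} + ⋯ + d_{k_{n-1},k_n}` over all chains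
`1 = k₁ ≤ k₂ ≤ ⋯ ≤ k_n = n`; the indices `1, …, n` are represented by `0, …, m`. -/
noncomputable def chainMax {m : ℕ} (d : Fin (m + 1) → Fin (m + 1) → WithBot ℕ) : WithBot ℕ :=
  (Finset.univ.filter fun k : Fin (m + 1) → Fin (m + 1) =>
      Monotone k ∧ k 0 = 0 ∧ k (Fin.last m) = Fin.last m).sup
    fun k => ∑ a : Fin m, d (k a.castSucc) (k a.succ)

/-! Upper bound: choose weights `w i` with deg `f i j` ≤ `w j - w i` for `i < j`. Matrix maps whose
`(i, j)` entry has degree ≤ `w j - w i - c` form a multiplicative filtration in `c`; `f⁻¹` lies in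
level 0, so each left or right difference raises the level of `f - 1` by one. At level `D ≥ max w`
every entry has degree ≤ 0, so `f` has degree ≤ `D` (`natDegreeLE_of_potential`). The longest-path
potential supplies such weights with maximum at most `chainMax δ` (`exists_potential`).

Lower bound: superdiagonal entries are homomorphisms, and these do not raise degree. That the
entries of a polynomial map are polynomial follows by induction on the degree and, inside it, on
rows from the bottom up (`exists_degLE_entries`). -/

/-! ### Degrees of real-valued polynomial maps. -/

section RealDegree

variable {S : Type*} [AddCommMonoid S]

/-- The real-valued polynomial maps of degree `< n`. -/
def degreeLT (S : Type*) [AddCommMonoid S] : ℕ → Submodule ℤ (S → ℝ)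
  | 0 => ⊥
  | n + 1 => ⨅ s : S, (degreeLT S n).comap (fwdDiff_aux.fwdDiffₗ S ℝ s)

theorem mem_degreeLT_zero {h : S → ℝ} : h ∈ degreeLT S 0 ↔ h = 0 := by
  simp [degreeLT]

theorem mem_degreeLT_succ {n : ℕ} {h : S → ℝ} :
    h ∈ degreeLT S (n + 1) ↔ ∀ s, fwdDiff s h ∈ degreeLT S n := by
  simp [degreeLT, fwdDiff_aux.fwdDiffₗ]

theorem degreeLT_mono : Monotone (degreeLT S) := by
  refine monotone_nat_of_le_succ fun n => ?_
  induction n with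
  | zero =>
    intro h hh
    rw [mem_degreeLT_zero] at hh
    subst hh
    exact zero_mem _
  | succ n ih =>
    intro h hh
    rw [mem_degreeLT_succ] at hh ⊢
    exact fun s => ih (hh s)

theorem fwdDiff_mem_degreeLT {n : ℕ} {h : S → ℝ} (hh : h ∈ degreeLT S n) (s : S) :
    fwdDiff s h ∈ degreeLT S (n - 1) := by
  cases n with
  | zero =>
    rw [mem_degreeLT_zero] at hh
    subst hh
    have : fwdDiff s (0 : S → ℝ) = 0 := by
      ext t
      simp [fwdDiff]
    rw [this]
    exact zero_mem _
  | succ n => exact mem_degreeLT_succ.1 hh s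

theorem shift_mem_degreeLT {n : ℕ} {h : S → ℝ} (hh : h ∈ degreeLT S n) (s : S) :
    (fun t => h (t + s)) ∈ degreeLT S n := by
  have : (fun t => h (t + s)) = fwdDiff s h + h := by
    ext t
    simp [fwdDiff]
  rw [this]
  exact add_mem (degreeLT_mono (Nat.sub_le n 1) (fwdDiff_mem_degreeLT hh s)) hh

theorem mem_degreeLT_one {h : S → ℝ} : h ∈ degreeLT S 1 ↔ ∃ c, ∀ t, h t = c := by
  rw [mem_degreeLT_succ]
  simp only [mem_degreeLT_zero]
  constructor
  · intro hh
    refine ⟨h 0, fun t => ?_⟩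
    have := congrFun (hh t) 0
    simp only [fwdDiff, zero_add, Pi.zero_apply] at this
    linarith
  · rintro ⟨c, hc⟩ s
    ext t
    simp [fwdDiff, hc]

theorem mul_mem_degreeLT {a b : ℕ} {g h : S → ℝ} (hg : g ∈ degreeLT S (a + 1))
    (hh : h ∈ degreeLT S (b + 1)) : g * h ∈ degreeLT S (a + b + 1) := by
  induction hn : a + b generalizing a b g h with
  | zero =>
    obtain ⟨rfl, rfl⟩ : a = 0 ∧ b = 0 := by omega
    rw [zero_add, mem_degreeLT_one] at *
    obtain ⟨c, hc⟩ := hg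
    obtain ⟨c', hc'⟩ := hh
    exact ⟨c * c', fun t => by simp [hc, hc']⟩
  | succ n ih =>
    rw [mem_degreeLT_succ]
    intro s
    -- Discrete Leibniz rule; the shift of `h` costs no degree.
    have key : fwdDiff s (g * h) = fwdDiff s g * (fun t => h (t + s)) + g * fwdDiff s h := by
      ext t
      simp [fwdDiff]
      ring
    rw [key]
    have hgs := fwdDiff_mem_degreeLT hg s
    have hhs := fwdDiff_mem_degreeLT hh s
    refine add_mem ?_ ?_
    · cases a with
      | zero =>
        rw [zero_add, Nat.sub_self, mem_degreeLT_zero] at hgs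
        rw [hgs, zero_mul]
        exact zero_mem _
      | succ a => exact ih hgs (shift_mem_degreeLT hh s) (by omega)
    · cases b with
      | zero =>
        rw [zero_add, Nat.sub_self, mem_degreeLT_zero] at hhs
        rw [hhs, mul_zero]
        exact zero_mem _
      | succ b => exact ih hg hhs (by omega)

/-- The real-valued polynomial maps of degree `≤ e`, where a negative `e` stands for `-∞`. -/
def degLE (S : Type*) [AddCommMonoid S] (e : ℤ) : Submodule ℤ (S → ℝ) :=
  degreeLT S (e + 1).toNat

theorem degLE_mono : Monotone (degLE S) := fun _ _ h => degreeLT_mono (by omega)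

theorem degLE_natCast (n : ℕ) : degLE S n = degreeLT S (n + 1) := by
  rw [degLE]
  congr 1

theorem eq_zero_of_mem_degLE {e : ℤ} (he : e < 0) {h : S → ℝ} (hh : h ∈ degLE S e) : h = 0 := by
  rw [degLE, show (e + 1).toNat = 0 by omega] at hh
  exact mem_degreeLT_zero.1 hh

theorem fwdDiff_mem_degLE {e : ℤ} {h : S → ℝ} (hh : h ∈ degLE S e) (s : S) :
    fwdDiff s h ∈ degLE S (e - 1) :=
  degreeLT_mono (by omega) (fwdDiff_mem_degreeLT hh s)

/-- For `e < 0` this fails: nonzero constants also have zero differences. -/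
theorem mem_degLE_of_fwdDiff {e : ℤ} (he : 0 ≤ e) {h : S → ℝ}
    (hh : ∀ s, fwdDiff s h ∈ degLE S (e - 1)) : h ∈ degLE S e := by
  rw [degLE, show (e + 1).toNat = (e - 1 + 1).toNat + 1 by omega, mem_degreeLT_succ]
  exact hh

/-- A negative index forces the factor to vanish, so additivity of degrees needs no sign conditions.
-/
theorem mul_mem_degLE {a b : ℤ} {g h : S → ℝ} (hg : g ∈ degLE S a) (hh : h ∈ degLE S b) :
    g * h ∈ degLE S (a + b) := by
  rcases lt_or_ge a 0 with ha | ha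
  · rw [eq_zero_of_mem_degLE ha hg, zero_mul]
    exact zero_mem _
  rcases lt_or_ge b 0 with hb | hb
  · rw [eq_zero_of_mem_degLE hb hh, mul_zero]
    exact zero_mem _
  lift a to ℕ using ha
  lift b to ℕ using hb
  rw [degLE_natCast] at hg hh
  rw [← Nat.cast_add, degLE_natCast]
  exact mul_mem_degreeLT hg hh

theorem const_mem_degLE {e : ℤ} (he : 0 ≤ e) (c : ℝ) : (fun _ => c) ∈ degLE S e :=
  degLE_mono he (by rw [← Nat.cast_zero, degLE_natCast]; exact mem_degreeLT_one.2 ⟨c, fun _ => rfl⟩)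

theorem eq_const_of_mem_degLE {e : ℤ} (he : e ≤ 0) {h : S → ℝ} (hh : h ∈ degLE S e) :
    ∃ c, ∀ t, h t = c := by
  have := degLE_mono he hh
  rw [← Nat.cast_zero, degLE_natCast] at this
  exact mem_degreeLT_one.1 this

/-- In a commutative target the left and right differences coincide. -/
theorem natDegreeLE_ofAdd_iff {n : ℕ} {h : S → ℝ} :
    NatDegreeLE n (fun t => Multiplicative.ofAdd (h t)) ↔ h ∈ degLE S n := by
  rw [degLE_natCast]
  induction n generalizing h with
  | zero =>
    rw [zero_add, mem_degreeLT_one]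
    exact ⟨fun ⟨g, hg⟩ => ⟨g.toAdd, fun t => congrArg Multiplicative.toAdd (hg t)⟩,
      fun ⟨c, hc⟩ => ⟨Multiplicative.ofAdd c, fun t => congrArg Multiplicative.ofAdd (hc t)⟩⟩
  | succ n ih =>
    rw [mem_degreeLT_succ, NatDegreeLE]
    refine forall_congr' fun s => ?_
    have hl : leftDiff s (fun t => Multiplicative.ofAdd (h t)) =
        fun t => Multiplicative.ofAdd (fwdDiff s h t) := by
      ext t
      simp [leftDiff, fwdDiff, add_comm s t, sub_eq_add_neg]
    have hr : rightDiff s (fun t => Multiplicative.ofAdd (h t)) =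
        fun t => Multiplicative.ofAdd (fwdDiff s h t) := by
      rw [← hl]
      ext t
      simp [leftDiff, rightDiff, mul_comm]
    rw [hl, hr, and_self, ih]

theorem mem_degLE_of_degreeLE {d : WithBot ℕ} {h : S → ℝ}
    (hd : DegreeLE d (fun t => Multiplicative.ofAdd (h t))) {e : ℤ}
    (he : ∀ n : ℕ, d = n → (n : ℤ) ≤ e) : h ∈ degLE S e := by
  rcases hd with h1 | ⟨n, rfl, hn⟩
  · have : h = 0 := funext fun t => congrArg Multiplicative.toAdd (h1 t)
    rw [this]
    exact zero_mem _
  · exact degLE_mono (he n rfl) (natDegreeLE_ofAdd_iff.1 hn)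

end RealDegree

/-! ### Homomorphisms and existence of the degree. -/

section Hom

variable {S G H : Type*} [Add S] [Group G] [Group H]

theorem NatDegreeLE.map (φ : G →* H) {n : ℕ} {f : S → G} (hf : NatDegreeLE n f) :
    NatDegreeLE n (fun t => φ (f t)) := by
  induction n generalizing f with
  | zero =>
    obtain ⟨g, hg⟩ := hf
    exact ⟨φ g, fun t => congrArg φ (hg t)⟩
  | succ n ih =>
    intro s
    have hl := ih (hf s).1
    have hr := ih (hf s).2
    simp only [leftDiff, rightDiff, map_mul, map_inv] at hl hr
    exact ⟨hl, hr⟩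

theorem DegreeLE.map (φ : G →* H) {d : WithBot ℕ} {f : S → G} (hf : DegreeLE d f) :
    DegreeLE d (fun t => φ (f t)) := by
  rcases hf with h | ⟨n, hd, hn⟩
  · exact Or.inl fun t => (congrArg φ (h t)).trans (map_one φ)
  · exact Or.inr ⟨n, hd, hn.map φ⟩

theorem IsPolynomialMap.exists_hasDegree {f : S → G} (hf : IsPolynomialMap f) :
    ∃ d, HasDegree f d := by
  let s : Set (WithBot ℕ) := {e | DegreeLE e f}
  have hs : s.Nonempty := hf
  exact ⟨wellFounded_lt.min s hs, wellFounded_lt.min_mem s hs,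
    fun e he => wellFounded_lt.min_le he⟩

end Hom

/-! ### Longest chains as a potential. -/

section Chain

variable {m : ℕ} (δ : Fin (m + 1) → Fin (m + 1) → WithBot ℕ)

open Classical in
/-- The chains starting at `0` that stay at `j` from time `j` onwards. -/
noncomputable def chainsTo (j : Fin (m + 1)) : Finset (Fin (m + 1) → Fin (m + 1)) :=
  Finset.univ.filter fun k => Monotone k ∧ k 0 = 0 ∧ ∀ a, j ≤ a → k a = j

/-- The largest value of the chains from `0` to `j`. -/
noncomputable def chainPotential (j : Fin (m + 1)) : WithBot ℕ :=
  (chainsTo j).sup fun k => ∑ a : Fin m, δ (k a.castSucc) (k a.succ)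

theorem chainPotential_last_le : chainPotential δ (Fin.last m) ≤ chainMax δ := by
  refine Finset.sup_mono fun k hk => ?_
  simp only [chainsTo, Finset.mem_filter, Finset.mem_univ, true_and] at hk ⊢
  exact ⟨hk.1, hk.2.1, hk.2.2 _ le_rfl⟩

variable {δ}

theorem chainPotential_zero_nonneg (h0 : ∀ i, δ i i = 0) : 0 ≤ chainPotential δ 0 := by
  have hk : (fun _ => 0 : Fin (m + 1) → Fin (m + 1)) ∈ chainsTo 0 := by
    simp [chainsTo, monotone_const]
  have := Finset.le_sup (f := fun k => ∑ a : Fin m, δ (k a.castSucc) (k a.succ)) hk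
  exact le_of_eq_of_le (by simp [h0]) this

/-- An optimal chain to `i` rests at `i` from time `i` on, hence at time `j - 1`; jumping to `j` at
the next step replaces one `δ i i = 0` by `δ i j`. -/
theorem chainPotential_add_le (h0 : ∀ i, δ i i = 0) {i j : Fin (m + 1)} (hij : i < j) :
    chainPotential δ i + δ i j ≤ chainPotential δ j := by
  rcases (chainsTo i).eq_empty_or_nonempty with he | hne
  · simp [chainPotential, he]
  obtain ⟨k, hk, hsup⟩ := Finset.exists_mem_eq_sup (chainsTo i) hne
    fun k => ∑ a : Fin m, δ (k a.castSucc) (k a.succ)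
  rw [chainPotential, hsup]
  simp only [chainsTo, Finset.mem_filter, Finset.mem_univ, true_and] at hk
  obtain ⟨hmono, hk0, hki⟩ := hk
  have hle : ∀ a, k a ≤ i := fun a => by
    rcases le_total i a with h | h
    · exact (hki a h).le
    · exact (hmono h).trans (hki i le_rfl).le
  let k' : Fin (m + 1) → Fin (m + 1) := fun a => if a < j then k a else j
  have hk' : k' ∈ chainsTo j := by
    simp only [chainsTo, Finset.mem_filter, Finset.mem_univ, true_and, k']
    refine ⟨fun a b hab => ?_, ?_, fun a ha => if_neg ha.not_gt⟩
    · dsimp only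
      split_ifs with h1 h2 h2
      · exact hmono hab
      · exact (hle a).trans hij.le
      · exact absurd (hab.trans_lt h2) h1
      · exact le_rfl
    · rw [if_pos ((Fin.zero_le i).trans_lt hij), hk0]
  refine le_of_eq_of_le ?_
    (Finset.le_sup (f := fun k => ∑ a : Fin m, δ (k a.castSucc) (k a.succ)) hk')
  obtain ⟨b, rfl⟩ := Fin.exists_succ_eq.2 ((Fin.zero_le i).trans_lt hij).ne'
  have hterm : ∀ a : Fin m, δ (k' a.castSucc) (k' a.succ) =
      δ (k a.castSucc) (k a.succ) + if a = b then δ i b.succ else 0 := by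
    intro a
    have hib : i ≤ b.castSucc := by
      rw [Fin.lt_def] at hij
      rw [Fin.le_def]
      simp at hij ⊢
      omega
    rcases lt_trichotomy a b with h | h | h
    · have h1 : a.succ < b.succ := Fin.succ_lt_succ_iff.2 h
      have h2 : a.castSucc < b.succ := a.castSucc_lt_succ.trans h1
      simp only [k', if_pos h1, if_pos h2, if_neg h.ne, add_zero]
    · subst h
      simp only [k', if_pos a.castSucc_lt_succ, lt_irrefl, if_false, if_true]
      rw [hki _ hib, hki _ (hib.trans a.castSucc_lt_succ.le), h0, zero_add]
    · have h2 : b.succ ≤ a.castSucc := by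
        rw [Fin.le_def]
        simpa using h
      have h1 : b.succ ≤ a.succ := h2.trans a.castSucc_lt_succ.le
      simp only [k', if_neg h1.not_gt, if_neg h2.not_gt, if_neg h.ne', add_zero]
      rw [hki _ (hij.le.trans h1), hki _ (hij.le.trans h2), h0, h0]
  simp only [hterm, Finset.sum_add_distrib, Finset.sum_ite_eq', Finset.mem_univ, if_true]

/-- Nonnegativity of `δ 0 j` keeps each potential away from `⊥`; nonnegativity of `δ j (Fin.last m)`
makes the last potential the largest. -/
theorem exists_potential (h0 : ∀ i, δ i i = 0)
    (hpos : ∀ i j, i < j → (i = 0 ∨ j = Fin.last m) → 0 ≤ δ i j) :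
    ∃ w : Fin (m + 1) → ℕ, (∀ i j, i < j → (w i : WithBot ℕ) + δ i j ≤ w j) ∧
      (∀ j, w j ≤ w (Fin.last m)) ∧ (w (Fin.last m) : WithBot ℕ) ≤ chainMax δ := by
  have hnn : ∀ j, 0 ≤ chainPotential δ j := by
    intro j
    rcases (Fin.zero_le j).eq_or_lt with rfl | hj
    · exact chainPotential_zero_nonneg h0
    · exact (add_nonneg (chainPotential_zero_nonneg h0) (hpos 0 j hj (Or.inl rfl))).trans
        (chainPotential_add_le h0 hj)
  have hex : ∀ j, ∃ n : ℕ, (n : WithBot ℕ) = chainPotential δ j := fun j =>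
    WithBot.ne_bot_iff_exists.1 fun h => by simpa [h] using hnn j
  choose w hw using hex
  refine ⟨w, fun i j hij => ?_, fun j => ?_, ?_⟩
  · rw [hw, hw]
    exact chainPotential_add_le h0 hij
  · rcases (Fin.le_last j).eq_or_lt with rfl | hj
    · exact le_rfl
    · have h1 := chainPotential_add_le h0 hj
      rw [← hw, ← hw] at h1
      have h2 : (w j : WithBot ℕ) ≤ w j + δ j (Fin.last m) :=
        le_add_of_nonneg_right (hpos j _ hj (Or.inr rfl))
      exact_mod_cast h2.trans h1
  · rw [hw]
    exact chainPotential_last_le δ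

end Chain

/-! ### The weighted filtration on matrix-valued maps. -/

section Weighted

variable {S : Type*} [AddCommMonoid S] {n : ℕ} {w : Fin n → ℕ}

/-- The `(i, j)` entry of `F` has degree at most `w j - w i - c`, for all `i` and `j`. -/
def WeightedDegLE (w : Fin n → ℕ) (c : ℤ) (F : S → Matrix (Fin n) (Fin n) ℝ) : Prop :=
  ∀ i j, (fun t => F t i j) ∈ degLE S ((w j : ℤ) - w i - c)

theorem WeightedDegLE.mul {a b : ℤ} {F H : S → Matrix (Fin n) (Fin n) ℝ}
    (hF : WeightedDegLE w a F) (hH : WeightedDegLE w b H) :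
    WeightedDegLE w (a + b) (fun t => F t * H t) := by
  intro i j
  have : (fun t => (F t * H t) i j) =
      ∑ k, (fun t => F t i k) * (fun t => H t k j) := by
    ext t
    simp [Matrix.mul_apply]
  rw [this]
  exact sum_mem fun k _ => degLE_mono (by omega) (mul_mem_degLE (hF i k) (hH k j))

theorem weightedDegLE_one :
    WeightedDegLE w 0 (fun _ : S => (1 : Matrix (Fin n) (Fin n) ℝ)) := by
  intro i j
  rcases eq_or_ne i j with rfl | h
  · exact const_mem_degLE (by omega) _
  · simp only [Matrix.one_apply_ne h]
    exact zero_mem _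

theorem WeightedDegLE.fwdDiff {c : ℤ} {F : S → Matrix (Fin n) (Fin n) ℝ}
    (hF : WeightedDegLE w c (fun t => F t - 1)) (s : S) :
    WeightedDegLE w (c + 1) (fun t => F (s + t) - F t) := by
  intro i j
  have : (fun t => (F (s + t) - F t) i j) = _root_.fwdDiff s (fun t => (F t - 1) i j) := by
    ext t
    simp [_root_.fwdDiff, add_comm s t]
  rw [this]
  exact degLE_mono (by omega) (fwdDiff_mem_degLE (hF i j) s)

theorem Unitriangular.sub_one_apply_of_le (A : Unitriangular n) {i j : Fin n} (h : j ≤ i) :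
    (A.1.1 - 1) i j = 0 := by
  rcases h.eq_or_lt with rfl | h
  · simp [A.2.1]
  · simp [A.2.2 i j h, Matrix.one_apply_ne h.ne']

theorem Unitriangular.coe_mul_coe_inv (A : Unitriangular n) : A.1.1 * (A⁻¹).1.1 = 1 := by
  have : (A * A⁻¹).1.1 = 1 := by
    rw [mul_inv_cancel]
    rfl
  exact this

theorem Unitriangular.coe_inv_mul_coe (A : Unitriangular n) : (A⁻¹).1.1 * A.1.1 = 1 := by
  simpa only [inv_inv] using Unitriangular.coe_mul_coe_inv A⁻¹

/-- From `A⁻¹ = 1 - (A - 1) * A⁻¹` with `A - 1` strictly upper triangular, row `i` of the inverse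
involves only rows `k > i`. -/
theorem WeightedDegLE.unitriangular {c : ℤ} (hc : 0 ≤ c) {f : S → Unitriangular n}
    (hf : WeightedDegLE w c (fun t => (f t).1.1 - 1)) :
    WeightedDegLE w 0 (fun t => ((f t)⁻¹).1.1) := by
  intro i
  induction i using WellFoundedGT.induction with
  | ind i ih =>
  intro j
  have : (fun t => ((f t)⁻¹).1.1 i j) = (fun _ => (1 : Matrix (Fin n) (Fin n) ℝ) i j) -
      ∑ k, (fun t => ((f t).1.1 - 1) i k) * (fun t => ((f t)⁻¹).1.1 k j) := by
    ext t
    have h : ((f t)⁻¹).1.1 = 1 - ((f t).1.1 - 1) * ((f t)⁻¹).1.1 := by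
      rw [sub_mul, Unitriangular.coe_mul_coe_inv]
      simp
    have := congrFun (congrFun h i) j
    rw [this]
    simp [Matrix.mul_apply]
  rw [this]
  refine sub_mem (weightedDegLE_one i j) (sum_mem fun k _ => ?_)
  rcases le_or_gt k i with h | h
  · have : (fun t => ((f t).1.1 - 1) i k) = 0 :=
      funext fun t => Unitriangular.sub_one_apply_of_le (f t) h
    rw [this, zero_mul]
    exact zero_mem _
  · exact degLE_mono (by omega) (mul_mem_degLE (hf i k) (ih k h j))

theorem WeightedDegLE.leftDiff {c : ℤ} (hc : 0 ≤ c) {f : S → Unitriangular n}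
    (hf : WeightedDegLE w c (fun t => (f t).1.1 - 1)) (s : S) :
    WeightedDegLE w (c + 1) (fun t => (_root_.leftDiff s f t).1.1 - 1) := by
  have h := (hf.fwdDiff s).mul (hf.unitriangular hc)
  rw [add_zero] at h
  convert h using 2 with t
  rw [sub_mul, Unitriangular.coe_mul_coe_inv]
  simp [_root_.leftDiff]

theorem WeightedDegLE.rightDiff {c : ℤ} (hc : 0 ≤ c) {f : S → Unitriangular n}
    (hf : WeightedDegLE w c (fun t => (f t).1.1 - 1)) (s : S) :
    WeightedDegLE w (c + 1) (fun t => (_root_.rightDiff s f t).1.1 - 1) := by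
  have h := (hf.unitriangular hc).mul (hf.fwdDiff s)
  rw [zero_add] at h
  convert h using 2 with t
  rw [mul_sub, Unitriangular.coe_inv_mul_coe]
  simp [_root_.rightDiff]

theorem WeightedDegLE.natDegreeLE {D : ℕ} (hD : ∀ j, w j ≤ D) (d : ℕ) {f : S → Unitriangular n}
    (c : ℕ) (hc : c + d = D) (hf : WeightedDegLE w c (fun t => (f t).1.1 - 1)) :
    NatDegreeLE d f := by
  induction d generalizing c f with
  | zero =>
    refine ⟨f 0, fun t => Subtype.ext (Subtype.ext (Matrix.ext fun i j => ?_))⟩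
    -- Here `c = D ≥ w j`, so the degree bound `w j - w i - c` is at most 0.
    obtain ⟨b, hb⟩ := eq_const_of_mem_degLE (by have := hD j; omega) (hf i j)
    have := (hb t).trans (hb 0).symm
    simpa using this
  | succ d ih =>
    exact fun s => ⟨ih (c + 1) (by omega) (by exact_mod_cast hf.leftDiff (by omega) s),
      ih (c + 1) (by omega) (by exact_mod_cast hf.rightDiff (by omega) s)⟩

theorem natDegreeLE_of_potential {D : ℕ} (hD : ∀ j, w j ≤ D) {f : S → Unitriangular n}
    (hf : ∀ i j, i < j → (fun t => (f t).1.1 i j) ∈ degLE S ((w j : ℤ) - w i)) :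
    NatDegreeLE D f := by
  refine WeightedDegLE.natDegreeLE hD D 0 (zero_add D) fun i j => ?_
  rcases le_or_gt j i with h | h
  · have : (fun t => ((f t).1.1 - 1) i j) = 0 :=
      funext fun t => Unitriangular.sub_one_apply_of_le (f t) h
    rw [this]
    exact zero_mem _
  · simpa [Matrix.one_apply_ne h.ne] using hf i j h

/-- `K` must not depend on `f`: the induction applies it to `leftDiff s f` for all `s` at once. -/
theorem exists_degLE_entries (n d : ℕ) :
    ∃ K : ℕ, ∀ f : S → Unitriangular n, NatDegreeLE d f →
      ∀ i j, (fun t => (f t).1.1 i j) ∈ degLE S K := by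
  induction d with
  | zero =>
    refine ⟨0, fun f ⟨g, hg⟩ i j => ?_⟩
    simp only [hg]
    exact const_mem_degLE (by simp) _
  | succ d ih =>
    obtain ⟨K, hK⟩ := ih
    refine ⟨(K + 1) * n, fun f hf => ?_⟩
    -- The row bound fits exactly: for `k ≥ i + 1`, `K + (K + 1) * (n - k) ≤ (K + 1) * (n - i) - 1`.
    suffices h : ∀ i j : Fin n, (fun t => (f t).1.1 i j) ∈ degLE S ((K + 1) * (n - (i : ℕ))) by
      refine fun i j => degLE_mono ?_ (h i j)
      push_cast
      gcongr
      omega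
    intro i
    induction i using WellFoundedGT.induction with
    | ind i ih =>
    intro j
    have hi : (1 : ℤ) ≤ n - (i : ℕ) := by have := i.2; omega
    refine mem_degLE_of_fwdDiff (by nlinarith) fun s => ?_
    have key : fwdDiff s (fun t => (f t).1.1 i j) =
        ∑ k, (fun t => ((leftDiff s f t).1.1 - 1) i k) * (fun t => (f t).1.1 k j) := by
      ext t
      have h : (f (s + t)).1.1 - (f t).1.1 = ((leftDiff s f t).1.1 - 1) * (f t).1.1 := by
        have : f (s + t) = leftDiff s f t * f t := by simp [leftDiff]
        rw [this, sub_mul]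
        simp
      have := congrFun (congrFun h i) j
      rw [fwdDiff, add_comm t s]
      simpa [Matrix.mul_apply] using this
    rw [key]
    refine sum_mem fun k _ => ?_
    rcases le_or_gt k i with h | h
    · have : (fun t => ((leftDiff s f t).1.1 - 1) i k) = 0 :=
        funext fun t => Unitriangular.sub_one_apply_of_le (leftDiff s f t) h
      rw [this, zero_mul]
      exact zero_mem _
    · have h1 : (fun t => ((leftDiff s f t).1.1 - 1) i k) ∈ degLE S K := by
        simpa [Matrix.one_apply_ne h.ne] using hK _ (hf s).1 i k
      refine degLE_mono ?_ (mul_mem_degLE h1 (ih k h j))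
      have hik : ((i : ℕ) : ℤ) + 1 ≤ (k : ℕ) := by exact_mod_cast h
      nlinarith

end Weighted

/-! ### The equivalence and the two degree bounds. -/

section Main

variable {S : Type*} [AddCommMonoid S] {m : ℕ} {f : S → Unitriangular (m + 1)}

theorem isPolynomialMap_iff_entryMap :
    IsPolynomialMap f ↔ ∀ i j : Fin (m + 1), i < j → IsPolynomialMap (entryMap f i j) := by
  constructor
  · rintro ⟨d, h1 | ⟨n, -, hn⟩⟩ i j hij
    · refine ⟨⊥, Or.inl fun t => ?_⟩
      simp [entryMap, h1, Matrix.one_apply_ne hij.ne]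
    · obtain ⟨K, hK⟩ := exists_degLE_entries (S := S) (m + 1) n
      exact ⟨K, Or.inr ⟨K, rfl, natDegreeLE_ofAdd_iff.2 (hK f hn i j)⟩⟩
  · intro h
    have h' : ∀ i j : Fin (m + 1), ∃ K : ℕ, i < j → (fun t => (f t).1.1 i j) ∈ degLE S K := by
      intro i j
      by_cases hij : i < j
      · obtain ⟨d, hd⟩ := h i j hij
        exact ⟨d.unbotD 0, fun _ => mem_degLE_of_degreeLE hd fun n hn => by simp [hn]⟩
      · exact ⟨0, fun h => absurd h hij⟩
    choose K hK using h'
    let B := Finset.univ.sup fun p : Fin (m + 1) × Fin (m + 1) => K p.1 p.2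
    have hB : ∀ i j, K i j ≤ B := fun i j =>
      Finset.le_sup (f := fun p : Fin (m + 1) × Fin (m + 1) => K p.1 p.2) (Finset.mem_univ (i, j))
    -- Linear weights `B * i` suffice, since `w j - w i ≥ B` for `i < j`.
    refine ⟨(B * m : ℕ), Or.inr ⟨_, rfl,
      natDegreeLE_of_potential (w := fun i => B * i) (fun j => ?_) fun i j hij => ?_⟩⟩
    · exact Nat.mul_le_mul_left _ (by omega)
    · refine degLE_mono ?_ (hK i j hij)
      have h1 : (K i j : ℤ) ≤ B := by exact_mod_cast hB i j
      have h2 : ((i : ℕ) : ℤ) + 1 ≤ (j : ℕ) := by exact_mod_cast hij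
      push_cast
      nlinarith

/-- The superdiagonal entries are group homomorphisms. -/
def superdiagHom (k : Fin m) : Unitriangular (m + 1) →* Multiplicative ℝ where
  toFun A := Multiplicative.ofAdd (A.1.1 k.castSucc k.succ)
  map_one' := by simp [Matrix.one_apply_ne k.castSucc_lt_succ.ne]
  map_mul' A B := by
    rw [← ofAdd_add]
    congr 1
    have hne : k.castSucc ≠ k.succ := k.castSucc_lt_succ.ne
    change (A.1 * B.1).1 k.castSucc k.succ = _
    rw [Matrix.SpecialLinearGroup.coe_mul, Matrix.mul_apply,
      Finset.sum_eq_add_of_mem _ _ (Finset.mem_univ k.castSucc) (Finset.mem_univ k.succ) hne]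
    · rw [A.2.1, B.2.1, one_mul, mul_one, add_comm]
    · rintro l - ⟨h1, h2⟩
      rcases lt_or_gt_of_ne h1 with h | h
      · rw [A.2.2 _ _ h, zero_mul]
      · have : k.succ < l := lt_of_le_of_ne (Fin.castSucc_lt_iff_succ_le.1 h) h2.symm
        rw [B.2.2 _ _ this, mul_zero]

theorem superdiagMax_le {d : Fin (m + 1) → Fin (m + 1) → WithBot ℕ}
    (hd : ∀ i j, i < j → HasDegree (entryMap f i j) (d i j)) {D : WithBot ℕ}
    (hD : DegreeLE D f) : superdiagMax d ≤ D :=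
  Finset.sup_le fun k _ => (hd _ _ k.castSucc_lt_succ).2 (hD.map (superdiagHom k))

theorem exists_degreeLE_le_chainMax {d δ : Fin (m + 1) → Fin (m + 1) → WithBot ℕ}
    (hd : ∀ i j, i < j → DegreeLE (d i j) (entryMap f i j)) (h0 : ∀ i, δ i i = 0)
    (hle : ∀ i j, i < j → d i j ≤ δ i j)
    (hpos : ∀ i j, i < j → (i = 0 ∨ j = Fin.last m) → 0 ≤ δ i j) :
    ∃ D : WithBot ℕ, DegreeLE D f ∧ D ≤ chainMax δ := by
  obtain ⟨w, hw, hlast, hmax⟩ := exists_potential h0 hpos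
  refine ⟨_, Or.inr ⟨_, rfl, natDegreeLE_of_potential hlast fun i j hij => ?_⟩, hmax⟩
  refine mem_degLE_of_degreeLE (hd i j hij) fun n hn => ?_
  have h1 : (w i : WithBot ℕ) + n ≤ w j :=
    (add_le_add_right (hn ▸ hle i j hij) _).trans (hw i j hij)
  have h2 : w i + n ≤ w j := by exact_mod_cast h1
  omega

end Main

theorem mainTheorem7 (N m : ℕ) (f : (Fin N → ℝ≥0) → Unitriangular (m + 1)) (hf : Continuous f) :
    (IsPolynomialMap f ↔ ∀ i j : Fin (m + 1), i < j → IsPolynomialMap (entryMap f i j)) ∧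
    ∀ d : Fin (m + 1) → Fin (m + 1) → WithBot ℕ,
      (∀ i j, i < j → HasDegree (entryMap f i j) (d i j)) →
      ∃ D : WithBot ℕ, HasDegree f D ∧
        superdiagMax d ≤ D ∧
        ∀ δ : Fin (m + 1) → Fin (m + 1) → WithBot ℕ,
          (∀ i, δ i i = 0) →
          (∀ i j, i < j → d i j ≤ δ i j) →
          (∀ i j, i < j → (i = 0 ∨ j = Fin.last m) → 0 ≤ δ i j) →
          D ≤ chainMax δ := by
  refine ⟨isPolynomialMap_iff_entryMap, fun d hd => ?_⟩
  obtain ⟨D, hD⟩ := (isPolynomialMap_iff_entryMap.2 fun i j hij =>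
    ⟨d i j, (hd i j hij).1⟩ : IsPolynomialMap f).exists_hasDegree
  refine ⟨D, hD, superdiagMax_le hd hD.1, fun δ h0 hle hpos => ?_⟩
  obtain ⟨E, hE, hEle⟩ := exists_degreeLE_le_chainMax (fun i j hij => (hd i j hij).1) h0 hle hpos
  exact (hD.2 hE).trans hEle
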